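/- **Theorem 3.9 (Local error).** Let $\mathsf H_1$ and $\mathsf H_0$ be complex Hilbert spaces with $\mathsf H_1\subseteq \mathsf H_0$ continuously embedded. Let $A$ be a (possibly unbounded) self-adjoint operator in $\mathsf H_1$ that has a self-adjoint extension $A_0$ in $\mathsf H_0$ whose domain contains $\mathsf H_1$, and let $\Phi^A$ be the strongly continuous one-parameter unitary group on $\mathsf H_1$ generated by $-iA$. Let $B:\mathsf H_1\to\mathsf H_1$ be locally Lipschitz, and let $B':\mathsf H_1\to\mathcal B(\mathsf H_0)$ be a map into the bounded (real-linear) operators on $\mathsf H_0$ such that for all $R,\varepsilon>0$ there are $C,\delta>0$ with $$\|B'(u)\|_{\mathcal B(\mathsf H_0)}\le C,\qquad \|B(u+w)-B(u)-B'(u)w\|_{\mathsf H_0}\le \varepsilon\|w\|_{\mathsf H_0}$$ for all $u,w\in \mathsf H_1$ with $\|u\|_{\mathsf H_1}\le R$ and $\|w\|_{\mathsf H_1}<\delta$. For $u_0\in\mathsf H_1$ let $\Phi(t)u_0=u(t)$, where $u\in C([0,T^*(u_0)),\mathsf H_1)$ is the maximal solution of $$u(t)=\Phi^A(t)u_0-i\int_0^t\Phi^A(t-s)B(u(s))\,ds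 .$$ Let $0<T<T^*(u_0)$, and let $\alpha,\beta:\mathbb R\to\mathbb R$ be measurable, (essentially) bounded, $T$-periodic functions with mean value $\frac1T\int_0^T\alpha=\frac1T\int_0^T\beta=1$. For $n\in\mathbb N$, $n\geq 1$, put $h_n=T/n$, $\alpha_n(t)=\alpha(nt)$, $\beta_n(t)=\beta(nt)$, and let $\Phi_n(t)u_0=u_n(t)$, where $u_n$ is the continuous $\mathsf H_1$-valued solution of $$u_n(t)=\Phi^A\Big(\int_0^t\alpha_n(r)\,dr\Big)u_0-i\int_0^t\beta_n(s)\,\Phi^A\Big(\int_s^t\alpha_n(r)\,dr\Big)B(u_n(s))\,ds .$$ Then there exist a constant $C>0$ and $n_0\in\mathbb N$ such that for all $n\ge n_0$ the value $\Phi_n(h_n)u_0$ is defined (the solution $u_n$ exists on $[0,h_n]$) and $$\|\Phi(h_n)u_0-\Phi_n(h_n)u_0\|_{\mathsf H_0}\le C\,h_n^2 .$$ -/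

import Mathlib

open MeasureTheory Set
open scoped NNReal ENNReal

namespace Splitting

noncomputable section

variable {H : Type*} [NormedAddCommGroup H] [InnerProductSpace ℂ H] [CompleteSpace H]

/-- `U` is the strongly continuous one-parameter unitary group with infinitesimal generator `-iA`:
the orbit of `x` is differentiable at time `0` exactly when `x` lies in the domain of `A`, and the
derivative is then `-iAx`. -/
structure IsUnitaryGroupGeneratedBy (A : H →ₗ.[ℂ] H) (U : ℝ → H →L[ℂ] H) : Prop where
  unitary_apply : ∀ t, U t ∈ unitary (H →L[ℂ] H)
  apply_zero : U 0 = 1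
  apply_add : ∀ s t, U (s + t) = U s * U t
  continuous_orbit : ∀ x, Continuous fun t => U t x
  generator : ∀ x y, HasDerivAt (fun t : ℝ => U t x) y 0 ↔
    ∃ hx : x ∈ A.domain, y = -(Complex.I • A ⟨x, hx⟩)

open Classical in
/-- `Φ^A`, the strongly continuous one-parameter unitary group generated by `-iA`. For self-adjoint
`A` it exists by Stone's theorem and is uniquely determined by `A`; the identity is a default value
for operators which do not generate such a group. -/
def unitaryGroup (A : H →ₗ.[ℂ] H) : ℝ → H →L[ℂ] H :=
  if h : ∃ U, IsUnitaryGroupGeneratedBy A U then h.choose else fun _ => 1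

/-- `u` is a solution on `[0, S]`, continuous with values in `H`, of the integral (Duhamel) form
`u(t) = Φ^A(τ(t,0)) u₀ - i ∫₀ᵗ β(s) Φ^A(τ(t,s)) B(u(s)) ds`, with `τ(t,s) = ∫ₛᵗ α`, of the
non-autonomous equation `u_t = -i (α(t) A u + β(t) B(u))`, `u(0) = u₀`. -/
structure IsMildSolution (A : H →ₗ.[ℂ] H) (B : H → H) (α β : ℝ → ℝ) (u₀ : H) (S : ℝ)
    (u : ℝ → H) : Prop where
  continuousOn : ContinuousOn u (Icc 0 S)
  duhamel : ∀ t ∈ Icc 0 S,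
    u t = unitaryGroup A (∫ r in (0 : ℝ)..t, α r) u₀
      - Complex.I • ∫ s in (0 : ℝ)..t, β s • unitaryGroup A (∫ r in s..t, α r) (B (u s))

/-- The flow of `-i(αA + βB)` starting from `u₀` is defined up to time `t`. -/
def FlowDefined (A : H →ₗ.[ℂ] H) (B : H → H) (α β : ℝ → ℝ) (t : ℝ) (u₀ : H) : Prop :=
  ∃ u : ℝ → H, IsMildSolution A B α β u₀ t u

open Classical in
/-- The flow of `-i(αA + βB)`: the value at time `t ≥ 0` of the (unique) solution starting from
`u₀`, with default value `0` when there is no solution on `[0, t]`. -/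
def flow (A : H →ₗ.[ℂ] H) (B : H → H) (α β : ℝ → ℝ) (t : ℝ) (u₀ : H) : H :=
  if h : FlowDefined A B α β t u₀ then h.choose t else 0

/-- The exact flow `Φ` of `-i(A + B)`; here `τ(t,s) = t - s`, so that the integral equation is
`u(t) = Φ^A(t) u₀ - i ∫₀ᵗ Φ^A(t - s) B(u(s)) ds`. -/
def exactFlow (A : H →ₗ.[ℂ] H) (B : H → H) (t : ℝ) (u₀ : H) : H :=
  flow A B (fun _ => 1) (fun _ => 1) t u₀

/-- The maximal existence time `T*(u₀)` of the exact flow. -/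
def maximalTime (A : H →ₗ.[ℂ] H) (B : H → H) (u₀ : H) : ℝ≥0∞ :=
  ⨆ (S : ℝ≥0) (_ : FlowDefined A B (fun _ => 1) (fun _ => 1) S u₀), (S : ℝ≥0∞)

/-- An admissible splitting coefficient: a real, (essentially) bounded, measurable, `T`-periodic
function with mean value `1`. -/
structure IsSplittingCoefficient (T : ℝ) (α : ℝ → ℝ) : Prop where
  bounded : MemLp α ∞ volume
  periodic : Function.Periodic α T
  mean_eq_one : T⁻¹ * ∫ t in (0 : ℝ)..T, α t = 1

/-- The flow `Φ_n` of `-i(α_n A + β_n B)` with `α_n(t) = α(nt)` and `β_n(t) = β(nt)`. -/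
def splittingFlow (A : H →ₗ.[ℂ] H) (B : H → H) (α β : ℝ → ℝ) (n : ℕ) (t : ℝ) (u₀ : H) : H :=
  flow A B (fun s => α (n * s)) (fun s => β (n * s)) t u₀

/-- `Φ_n(t) u₀` is defined. -/
def SplittingFlowDefined (A : H →ₗ.[ℂ] H) (B : H → H) (α β : ℝ → ℝ) (n : ℕ) (t : ℝ) (u₀ : H) :
    Prop :=
  FlowDefined A B (fun s => α (n * s)) (fun s => β (n * s)) t u₀

variable {H₁ H₀ : Type*} [NormedAddCommGroup H₁] [InnerProductSpace ℂ H₁]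
  [NormedAddCommGroup H₀] [InnerProductSpace ℂ H₀]

/-- The operator `A₀` in `H₀` extends the operator `A` in `H₁`, where `ι : H₁ → H₀` is the
embedding. -/
def Extends (ι : H₁ →L[ℂ] H₀) (A : H₁ →ₗ.[ℂ] H₁) (A₀ : H₀ →ₗ.[ℂ] H₀) : Prop :=
  ∀ x : A.domain, ∃ hx : ι x ∈ A₀.domain, A₀ ⟨ι x, hx⟩ = ι (A x)

/-- The linearization estimates for `B : H₁ → H₁` and `B'`, with values in the bounded operators on
`H₀`. The operators `B'(u)` only have to be real-linear, as is needed for nonlinearities such as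
`|u|²u`. -/
def LinearizationEstimates (ι : H₁ →L[ℂ] H₀) (B : H₁ → H₁) (B' : H₁ → H₀ →L[ℝ] H₀) : Prop :=
  ∀ R : ℝ, 0 < R → ∀ ε : ℝ, 0 < ε → ∃ C δ : ℝ, 0 < δ ∧ ∀ u w : H₁, ‖u‖ ≤ R → ‖w‖ < δ →
    ‖B' u‖ ≤ C ∧ ‖ι (B (u + w)) - ι (B u) - B' u (ι w)‖ ≤ ε * ‖ι w‖

end

end Splitting

/-! Both flows are compared with the single step `Φ^A(h) u₀ - i h B(u₀)`, `h = T/n`; each differs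
from it by `O(h²)` in `H₀`, and the triangle inequality concludes. Since `α` and `β` have mean one
over a period, `α_n` and `β_n` have integral exactly `h` over `[0, h]`. Hence the linear term of the
Duhamel formula is `Φ^A(h) u₀` in both cases, and `h B(u₀)` can be written as `∫ β_n B(u₀)`. What
remains is the integral of `β_n (Φ^A(τ) B(u(s)) - B(u₀))`, whose integrand has to be `O(h)` in `H₀`.

Two Lipschitz bounds give this. By the closed graph theorem `A₀` is bounded from `H₁` to `H₀`, so
orbits of `Φ^A` are Lipschitz in time for the `H₀` norm (`exists_norm_unitaryGroup_sub_le`). The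
linearization estimates make `B` Lipschitz at `u₀` in the `H₀` norm, while `u(s)` is within `O(s)`
of `u₀` there.

The constants and the existence time must not depend on `n`. Rescaling preserves the essential bound
`K` of the coefficients, and everything is estimated through `K` alone
(`exists_norm_flow_sub_euler_le`). -/

namespace Splitting

/-! ### Strongly continuous isometry groups -/

section IsometryGroup

variable {H : Type*} [NormedAddCommGroup H] [InnerProductSpace ℂ H]

/-- A strongly continuous one-parameter group of linear isometries. -/
structure IsIsometryGroup (U : ℝ → H →L[ℂ] H) : Prop where
  norm_apply : ∀ t x, ‖U t x‖ = ‖x‖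
  apply_zero : U 0 = 1
  apply_add : ∀ s t, U (s + t) = U s * U t
  continuous_orbit : ∀ x, Continuous fun t => U t x

theorem IsUnitaryGroupGeneratedBy.isIsometryGroup [CompleteSpace H] {A : H →ₗ.[ℂ] H}
    {U : ℝ → H →L[ℂ] H} (hU : IsUnitaryGroupGeneratedBy A U) : IsIsometryGroup U where
  norm_apply t x := ContinuousLinearMap.norm_map_of_mem_unitary (hU.unitary_apply t) x
  apply_zero := hU.apply_zero
  apply_add := hU.apply_add
  continuous_orbit := hU.continuous_orbit

/-- The constant identity, the default value, is also an isometry group, so Stone's theorem is not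
needed. -/
theorem isIsometryGroup_unitaryGroup [CompleteSpace H] (A : H →ₗ.[ℂ] H) :
    IsIsometryGroup (unitaryGroup A) := by
  by_cases h : ∃ U, IsUnitaryGroupGeneratedBy A U
  · rw [unitaryGroup, dif_pos h]
    exact h.choose_spec.isIsometryGroup
  · rw [unitaryGroup, dif_neg h]
    exact ⟨fun _ _ => rfl, rfl, fun _ _ => (mul_one _).symm, fun _ => continuous_const⟩

theorem IsIsometryGroup.continuous_uncurry {U : ℝ → H →L[ℂ] H} (hU : IsIsometryGroup U) :
    Continuous fun p : ℝ × H => U p.1 p.2 := by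
  refine continuous_iff_continuousAt.2 fun ⟨t, x⟩ => ?_
  rw [ContinuousAt, tendsto_iff_norm_sub_tendsto_zero]
  have h1 : Filter.Tendsto (fun p : ℝ × H => ‖p.2 - x‖ + ‖U p.1 x - U t x‖) (nhds (t, x))
      (nhds (‖x - x‖ + ‖U t x - U t x‖)) := by
    have h2 : Continuous fun p : ℝ × H => U p.1 x := (hU.continuous_orbit x).comp continuous_fst
    exact ((continuous_snd.sub continuous_const).norm.add
      (h2.sub continuous_const).norm).tendsto (t, x)
  simp only [sub_self, norm_zero, add_zero] at h1
  refine squeeze_zero (fun _ => norm_nonneg _) (fun p => ?_) h1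
  calc ‖U p.1 p.2 - U t x‖ = ‖U p.1 (p.2 - x) + (U p.1 x - U t x)‖ := by
        rw [map_sub]; congr 1; abel
    _ ≤ ‖U p.1 (p.2 - x)‖ + ‖U p.1 x - U t x‖ := norm_add_le _ _
    _ = _ := by rw [hU.norm_apply]

theorem IsIsometryGroup.exists_norm_sub_le {U : ℝ → H →L[ℂ] H} (hU : IsIsometryGroup U) (x : H)
    {ε : ℝ} (hε : 0 < ε) : ∃ η > 0, ∀ t, |t| ≤ η → ‖U t x - x‖ ≤ ε := by
  obtain ⟨η, hη, h⟩ := Metric.continuous_iff.1 (hU.continuous_orbit x) 0 ε hε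
  refine ⟨η / 2, half_pos hη, fun t ht => ?_⟩
  have := h t (by rw [Real.dist_eq, sub_zero]; linarith)
  simp only [hU.apply_zero, one_apply_eq_self, dist_eq_norm] at this
  exact this.le

end IsometryGroup

/-! ### Lipschitz orbits in the larger space -/

section GeneratorBound

variable {H₁ H₀ : Type*}
  [NormedAddCommGroup H₁] [InnerProductSpace ℂ H₁] [CompleteSpace H₁]
  [NormedAddCommGroup H₀] [InnerProductSpace ℂ H₀] [CompleteSpace H₀]

/-- By the closed graph theorem, a self-adjoint operator is bounded on a continuously embedded
space which its domain contains. -/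
theorem exists_norm_apply_le_of_mem_domain (ι : H₁ →L[ℂ] H₀) {A₀ : H₀ →ₗ.[ℂ] H₀}
    (hA₀ : IsSelfAdjoint A₀) (hdom : ∀ x : H₁, ι x ∈ A₀.domain) :
    ∃ M : ℝ, 0 ≤ M ∧ ∀ x : H₁, ‖A₀ ⟨ι x, hdom x⟩‖ ≤ M * ‖x‖ := by
  let g : H₁ →ₗ[ℂ] H₀ := A₀.toFun ∘ₗ (ι : H₁ →ₗ[ℂ] H₀).codRestrict A₀.domain hdom
  have hcl : IsClosed (A₀.graph : Set (H₀ × H₀)) := hA₀.isClosed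
  let G : H₁ →L[ℂ] H₀ := ContinuousLinearMap.ofSeqClosedGraph (g := g) (by
    intro u x y hx hy
    have hmem : (ι x, y) ∈ (A₀.graph : Set (H₀ × H₀)) := by
      refine hcl.mem_of_tendsto (((ι.continuous.tendsto x).comp hx).prodMk_nhds hy)
        (Filter.Eventually.of_forall fun n => ?_)
      exact A₀.mem_graph ⟨ι (u n), hdom (u n)⟩
    obtain ⟨z, hz, hz'⟩ := (LinearPMap.mem_graph_iff _).1 hmem
    have : z = ⟨ι x, hdom x⟩ := Subtype.ext hz
    subst this
    exact hz'.symm)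
  exact ⟨‖G‖, norm_nonneg _, fun x => G.le_opNorm x⟩

/-- The group law carries the derivative at `0` to time `t`; since `U t` commutes with the group,
the orbit of `U t x` is differentiable at `0`, so `U t x` is again in the domain. -/
theorem IsUnitaryGroupGeneratedBy.hasDerivAt {A : H₁ →ₗ.[ℂ] H₁} {U : ℝ → H₁ →L[ℂ] H₁}
    (hU : IsUnitaryGroupGeneratedBy A U) (x : A.domain) (t : ℝ) :
    ∃ y : A.domain, (y : H₁) = U t x ∧
      HasDerivAt (fun s : ℝ => U s (x : H₁)) (-(Complex.I • A y)) t := by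
  have h0 : HasDerivAt (fun s : ℝ => U s (x : H₁)) (-(Complex.I • A x)) 0 :=
    (hU.generator _ _).2 ⟨x.2, rfl⟩
  have h1 : HasDerivAt (fun s : ℝ => U t (U s (x : H₁))) (U t (-(Complex.I • A x))) 0 :=
    ((U t).restrictScalars ℝ).hasFDerivAt.comp_hasDerivAt (0 : ℝ) h0
  have h2 : HasDerivAt (fun s : ℝ => U s (U t (x : H₁))) (U t (-(Complex.I • A x))) 0 := by
    convert h1 using 1
    funext s
    rw [← mul_apply_eq_comp, ← mul_apply_eq_comp, ← hU.apply_add,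
      ← hU.apply_add, add_comm]
  obtain ⟨hx, hy⟩ := (hU.generator _ _).1 h2
  refine ⟨⟨U t x, hx⟩, rfl, ?_⟩
  rw [← hy]
  have h3 : HasDerivAt (fun s : ℝ => U t (U (s - t) (x : H₁))) (U t (-(Complex.I • A x))) t := by
    have h1' : HasDerivAt (fun s : ℝ => U t (U s (x : H₁))) (U t (-(Complex.I • A x))) (t - t) := by
      rwa [sub_self]
    exact h1'.comp_sub_const t t
  convert h3 using 1
  funext s
  rw [← mul_apply_eq_comp, ← hU.apply_add, add_sub_cancel]

/-- In the norm of the larger space, the orbits of the unitary group are Lipschitz continuous. -/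
theorem IsUnitaryGroupGeneratedBy.exists_norm_embedding_sub_le (ι : H₁ →L[ℂ] H₀)
    {A : H₁ →ₗ.[ℂ] H₁} (hA : IsSelfAdjoint A) {A₀ : H₀ →ₗ.[ℂ] H₀} (hA₀ : IsSelfAdjoint A₀)
    (hext : Extends ι A A₀) (hdom : ∀ x : H₁, ι x ∈ A₀.domain) {U : ℝ → H₁ →L[ℂ] H₁}
    (hU : IsUnitaryGroupGeneratedBy A U) :
    ∃ M : ℝ, 0 ≤ M ∧ ∀ t x, ‖ι (U t x) - ι x‖ ≤ M * |t| * ‖x‖ := by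
  obtain ⟨M, hM, hMA⟩ := exists_norm_apply_le_of_mem_domain ι hA₀ hdom
  refine ⟨M, hM, fun t x => ?_⟩
  -- Both sides are continuous in `x`, so the dense domain of `A` suffices. There the mean value
  -- inequality applies, with derivative bounded by `M * ‖U s x‖ = M * ‖x‖`.
  refine hA.dense_domain.induction (P := fun x => ‖ι (U t x) - ι x‖ ≤ M * |t| * ‖x‖) ?_ ?_ x
  · intro x hx
    choose y hyU hy using fun s => hU.hasDerivAt ⟨x, hx⟩ s
    have hd : ∀ s ∈ (univ : Set ℝ),
        HasDerivWithinAt (fun s : ℝ => ι (U s x)) (ι (-(Complex.I • A (y s)))) univ s := fun s _ =>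
      ((ι.restrictScalars ℝ).hasFDerivAt.comp_hasDerivAt s (hy s)).hasDerivWithinAt
    have hb : ∀ s ∈ (univ : Set ℝ), ‖ι (-(Complex.I • A (y s)))‖ ≤ M * ‖x‖ := by
      intro s _
      obtain ⟨h, hA'⟩ := hext (y s)
      rw [map_neg, map_smul, norm_neg, norm_smul, Complex.norm_I, one_mul, ← hA']
      refine (hMA (y s)).trans_eq ?_
      rw [hyU, hU.isIsometryGroup.norm_apply]
    have := convex_univ.norm_image_sub_le_of_norm_hasDerivWithin_le hd hb (mem_univ 0) (mem_univ t)
    simp only [hU.apply_zero, one_apply_eq_self, sub_zero, Real.norm_eq_abs] at this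
    linarith
  · exact isClosed_le (by fun_prop) (by fun_prop)

/-- The Lipschitz bound for `Φ^A`. The case without a generated group, which does not occur by Stone's
theorem, need not be excluded: the bound is trivial for the identity. -/
theorem exists_norm_unitaryGroup_sub_le (ι : H₁ →L[ℂ] H₀)
    {A : H₁ →ₗ.[ℂ] H₁} (hA : IsSelfAdjoint A) {A₀ : H₀ →ₗ.[ℂ] H₀} (hA₀ : IsSelfAdjoint A₀)
    (hext : Extends ι A A₀) (hdom : ∀ x : H₁, ι x ∈ A₀.domain) :
    ∃ M : ℝ, 0 ≤ M ∧ ∀ t x, ‖ι (unitaryGroup A t x) - ι x‖ ≤ M * |t| * ‖x‖ := by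
  by_cases h : ∃ U, IsUnitaryGroupGeneratedBy A U
  · rw [unitaryGroup, dif_pos h]
    exact h.choose_spec.exists_norm_embedding_sub_le ι hA hA₀ hext hdom
  · rw [unitaryGroup, dif_neg h]
    exact ⟨0, le_rfl, fun t x => by simp⟩

end GeneratorBound

/-! ### Essentially bounded coefficients -/

section Coefficients

/-- A measurable coefficient which is essentially bounded by `K`. -/
structure IsBoundedCoefficient (K : ℝ) (a : ℝ → ℝ) : Prop where
  aestronglyMeasurable : AEStronglyMeasurable a volume
  ae_norm_le : ∀ᵐ t, ‖a t‖ ≤ K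

variable {K : ℝ} {a : ℝ → ℝ}

theorem IsBoundedCoefficient.mono (ha : IsBoundedCoefficient K a) {K' : ℝ} (h : K ≤ K') :
    IsBoundedCoefficient K' a :=
  ⟨ha.1, ha.2.mono fun _ ht => ht.trans h⟩

theorem IsBoundedCoefficient.nonneg (ha : IsBoundedCoefficient K a) : 0 ≤ K := by
  obtain ⟨t, ht⟩ := ha.ae_norm_le.exists
  exact (norm_nonneg _).trans ht

theorem isBoundedCoefficient_one : IsBoundedCoefficient 1 fun _ => 1 :=
  ⟨aestronglyMeasurable_const, Filter.Eventually.of_forall fun _ => by simp⟩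

theorem exists_isBoundedCoefficient (ha : MemLp a ∞ volume) :
    ∃ K, IsBoundedCoefficient K a := by
  refine ⟨(eLpNormEssSup a volume).toReal, ha.1, ?_⟩
  have hfin : eLpNormEssSup a volume ≠ ∞ := by
    rw [← eLpNorm_exponent_top]; exact ha.2.ne
  filter_upwards [ae_le_eLpNormEssSup (f := a) (μ := volume)] with t ht
  simpa using ENNReal.toReal_mono hfin ht

theorem IsBoundedCoefficient.comp_mul_left (ha : IsBoundedCoefficient K a) {c : ℝ} (hc : c ≠ 0) :
    IsBoundedCoefficient K fun t => a (c * t) := by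
  have hq : Measure.QuasiMeasurePreserving (fun t : ℝ => c * t) volume volume := by
    refine ⟨measurable_const_mul c, ?_⟩
    rw [Real.map_volume_mul_left hc]
    exact Measure.smul_absolutelyContinuous
  exact ⟨ha.1.comp_quasiMeasurePreserving hq, hq.ae ha.2⟩

theorem IsBoundedCoefficient.intervalIntegrable_smul {E : Type*} [NormedAddCommGroup E]
    [NormedSpace ℝ E] (ha : IsBoundedCoefficient K a) {g : ℝ → E} {s t : ℝ}
    (hg : ContinuousOn g (uIcc s t)) : IntervalIntegrable (fun r => a r • g r) volume s t := by
  have h := hg.intervalIntegrable (μ := volume)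
  rw [intervalIntegrable_iff] at h ⊢
  exact h.bdd_smul K ha.1.restrict (ae_restrict_of_ae ha.2)

theorem IsBoundedCoefficient.intervalIntegrable (ha : IsBoundedCoefficient K a) (s t : ℝ) :
    IntervalIntegrable a volume s t := by
  simpa using ha.intervalIntegrable_smul (g := fun _ => (1 : ℝ)) (s := s) (t := t)
    continuousOn_const

theorem IsBoundedCoefficient.continuous_primitive (ha : IsBoundedCoefficient K a) :
    Continuous fun t => ∫ r in (0 : ℝ)..t, a r :=
  intervalIntegral.continuous_primitive ha.intervalIntegrable 0

theorem IsBoundedCoefficient.abs_integral_le (ha : IsBoundedCoefficient K a) (s t : ℝ) :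
    |∫ r in s..t, a r| ≤ K * |t - s| :=
  intervalIntegral.norm_integral_le_of_norm_le_const_ae (ha.2.mono fun _ h _ => h)

theorem IsBoundedCoefficient.integral_eq_add_neg (ha : IsBoundedCoefficient K a) (s t : ℝ) :
    ∫ r in s..t, a r = (∫ r in (0 : ℝ)..t, a r) + -∫ r in (0 : ℝ)..s, a r := by
  rw [← sub_eq_add_neg, intervalIntegral.integral_interval_sub_left (ha.intervalIntegrable _ _)
    (ha.intervalIntegrable _ _)]

/-- The open interval is deliberate: at a first exit time the bound on `g` is known only strictly
before `t`. -/
theorem IsBoundedCoefficient.norm_integral_smul_le {E : Type*} [NormedAddCommGroup E]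
    [NormedSpace ℝ E] (ha : IsBoundedCoefficient K a) {g : ℝ → E} {t M : ℝ} (ht : 0 ≤ t)
    (hg : ∀ s ∈ Ioo 0 t, ‖g s‖ ≤ M) : ‖∫ s in (0 : ℝ)..t, a s • g s‖ ≤ K * M * t := by
  have h : ∀ᵐ s : ℝ, s ∈ uIoc 0 t → ‖a s • g s‖ ≤ K * M := by
    filter_upwards [ha.2, Measure.ae_ne volume t] with s hs hst hmem
    rw [uIoc_of_le ht] at hmem
    rw [norm_smul]
    exact mul_le_mul hs (hg s ⟨hmem.1, lt_of_le_of_ne hmem.2 hst⟩) (norm_nonneg _) ha.nonneg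
  simpa [abs_of_nonneg ht] using intervalIntegral.norm_integral_le_of_norm_le_const_ae h

theorem IsSplittingCoefficient.integral_comp_mul_left {T : ℝ} (hT : 0 < T)
    (ha : IsSplittingCoefficient T a) {n : ℕ} (hn : n ≠ 0) :
    ∫ t in (0 : ℝ)..T / n, a (n * t) = T / n := by
  have hn' : (n : ℝ) ≠ 0 := Nat.cast_ne_zero.2 hn
  have hmean := ha.mean_eq_one
  rw [intervalIntegral.integral_comp_mul_left _ hn', mul_zero, mul_div_cancel₀ _ hn', smul_eq_mul]
  field_simp at hmean ⊢
  exact hmean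

end Coefficients

/-! ### Local existence and a priori bounds -/

section Solutions

variable {H : Type*} [NormedAddCommGroup H] [InnerProductSpace ℂ H] [CompleteSpace H]
  {A : H →ₗ.[ℂ] H} {B : H → H} {a b : ℝ → ℝ} {u₀ : H} {K S ρ M : ℝ}

theorem continuousOn_unitaryGroup_apply (A : H →ₗ.[ℂ] H) {f : ℝ → ℝ} {g : ℝ → H} {s : Set ℝ}
    (hf : ContinuousOn f s) (hg : ContinuousOn g s) :
    ContinuousOn (fun t => unitaryGroup A (f t) (g t)) s :=
  (isIsometryGroup_unitaryGroup A).continuous_uncurry.comp_continuousOn (hf.prodMk hg)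

theorem intervalIntegrable_duhamel (A : H →ₗ.[ℂ] H) (ha : IsBoundedCoefficient K a)
    (hb : IsBoundedCoefficient K b) {g : ℝ → H} {t : ℝ} (hg : ContinuousOn g (uIcc 0 t)) :
    IntervalIntegrable (fun s => b s • unitaryGroup A (∫ r in s..t, a r) (g s)) volume 0 t := by
  refine hb.intervalIntegrable_smul (continuousOn_unitaryGroup_apply A ?_ hg)
  rw [funext fun s => ha.integral_eq_add_neg s t]
  exact (continuous_const.add ha.continuous_primitive.neg).continuousOn

/-- The group law pulls `Φ^A(∫₀ᵗ a)` out of the integral, leaving an integrand independent of `t`.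
-/
theorem continuous_duhamel (A : H →ₗ.[ℂ] H) (ha : IsBoundedCoefficient K a)
    (hb : IsBoundedCoefficient K b) {g : ℝ → H} (hg : Continuous g) :
    Continuous fun t => ∫ s in (0 : ℝ)..t, b s • unitaryGroup A (∫ r in s..t, a r) (g s) := by
  have hU := isIsometryGroup_unitaryGroup A
  have hcont : Continuous fun s => unitaryGroup A (-∫ r in (0 : ℝ)..s, a r) (g s) :=
    hU.continuous_uncurry.comp (ha.continuous_primitive.neg.prodMk hg)
  have hint : ∀ s t, IntervalIntegrable
      (fun s => b s • unitaryGroup A (-∫ r in (0 : ℝ)..s, a r) (g s)) volume s t := fun s t =>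
    hb.intervalIntegrable_smul hcont.continuousOn
  have heq : ∀ t, ∫ s in (0 : ℝ)..t, b s • unitaryGroup A (∫ r in s..t, a r) (g s) =
      unitaryGroup A (∫ r in (0 : ℝ)..t, a r)
        (∫ s in (0 : ℝ)..t, b s • unitaryGroup A (-∫ r in (0 : ℝ)..s, a r) (g s)) := by
    intro t
    rw [← ContinuousLinearMap.intervalIntegral_comp_comm _ (hint 0 t)]
    refine intervalIntegral.integral_congr fun s _ => ?_
    rw [ContinuousLinearMap.map_smul_of_tower, ha.integral_eq_add_neg s t, hU.apply_add,
      mul_apply_eq_comp]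
  simp_rw [heq]
  exact hU.continuous_uncurry.comp
    (ha.continuous_primitive.prodMk (intervalIntegral.continuous_primitive hint 0))

/-- Each of the two terms contributes at most `ρ / 3`. This serves both as the self-map property of
the fixed point map and, by strictness, to exclude exit from the ball. -/
theorem norm_duhamel_sub_lt (ha : IsBoundedCoefficient K a) (hb : IsBoundedCoefficient K b)
    (hρ : 0 < ρ) (hUS : ∀ t, |t| ≤ K * S → ‖unitaryGroup A t u₀ - u₀‖ ≤ ρ / 3)
    (hMS : K * M * S ≤ ρ / 3) {t : ℝ} (ht : t ∈ Icc 0 S) {g : ℝ → H}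
    (hg : ∀ s ∈ Ioo 0 t, ‖g s‖ ≤ M) :
    ‖unitaryGroup A (∫ r in (0 : ℝ)..t, a r) u₀
      - Complex.I • (∫ s in (0 : ℝ)..t, b s • unitaryGroup A (∫ r in s..t, a r) (g s)) - u₀‖
        < ρ := by
  have h1 := hUS (∫ r in (0 : ℝ)..t, a r) <| (ha.abs_integral_le 0 t).trans <| by
    rw [sub_zero, abs_of_nonneg ht.1]
    exact mul_le_mul_of_nonneg_left ht.2 ha.nonneg
  have h2 := hb.norm_integral_smul_le (M := M) ht.1
    (g := fun s => unitaryGroup A (∫ r in s..t, a r) (g s))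
    (fun s hs => by rw [(isIsometryGroup_unitaryGroup A).norm_apply]; exact hg s hs)
  have h3 : K * M * t ≤ ρ / 3 := by
    rcases le_or_gt 0 (K * M) with h | h
    · exact (mul_le_mul_of_nonneg_left ht.2 h).trans hMS
    · nlinarith [ht.1]
  rw [sub_right_comm]
  refine (norm_sub_le _ _).trans_lt ?_
  rw [norm_smul, Complex.norm_I, one_mul]
  linarith

/-- For short times, solutions stay close to the initial value. -/
theorem IsMildSolution.norm_sub_lt (ha : IsBoundedCoefficient K a)
    (hb : IsBoundedCoefficient K b) (hρ : 0 < ρ)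
    (hUS : ∀ t, |t| ≤ K * S → ‖unitaryGroup A t u₀ - u₀‖ ≤ ρ / 3) (hMS : K * M * S ≤ ρ / 3)
    (hM : ∀ x, ‖x - u₀‖ ≤ ρ → ‖B x‖ ≤ M) {u : ℝ → H} (hu : IsMildSolution A B a b u₀ S u)
    {t : ℝ} (ht : t ∈ Icc 0 S) : ‖u t - u₀‖ < ρ := by
  by_contra hcon
  -- The set of times outside the open ball is compact; before its least element `τ` the solution is
  -- in the ball, which forces `‖u τ - u₀‖ < ρ`.
  let Z : Set ℝ := Icc 0 S ∩ (fun t => ‖u t - u₀‖) ⁻¹' Ici ρ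
  have hZ : IsCompact Z := isCompact_Icc.of_isClosed_subset
    ((hu.continuousOn.sub continuousOn_const).norm.preimage_isClosed_of_isClosed isClosed_Icc
      isClosed_Ici) inter_subset_left
  obtain ⟨τ, ⟨hτ, hτρ⟩, hmin⟩ := hZ.exists_isLeast ⟨t, ht, not_lt.1 hcon⟩
  refine absurd (show ρ ≤ ‖u τ - u₀‖ from hτρ) (not_le.2 ?_)
  rw [hu.duhamel τ hτ]
  refine norm_duhamel_sub_lt ha hb hρ hUS hMS hτ fun s hs => hM _ ?_
  by_contra hs'
  exact absurd (hmin ⟨⟨hs.1.le, hs.2.le.trans hτ.2⟩, (not_le.1 hs').le⟩) (not_le.2 hs.2)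

/-- Local existence of solutions, with a lower bound on the existence time which depends on the
coefficients only through their essential bound. -/
theorem flowDefined_of_lipschitzOnWith (hB : Continuous B) {L : ℝ≥0}
    (hL : LipschitzOnWith L B (Metric.closedBall u₀ ρ)) (ha : IsBoundedCoefficient K a)
    (hb : IsBoundedCoefficient K b) (hS : 0 ≤ S) (hρ : 0 < ρ)
    (hUS : ∀ t, |t| ≤ K * S → ‖unitaryGroup A t u₀ - u₀‖ ≤ ρ / 3) (hMS : K * M * S ≤ ρ / 3)
    (hM : ∀ x, ‖x - u₀‖ ≤ ρ → ‖B x‖ ≤ M) (hLS : K * L * S ≤ 1 / 2) :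
    FlowDefined A B a b S u₀ := by
  have hUiso := isIsometryGroup_unitaryGroup A
  -- Paths on `[0, S]` are extended to the line by `projIcc`, so that the Duhamel integral is
  -- defined for a continuous function on `ℝ`.
  let g : C(Icc 0 S, H) → ℝ → H := fun v s => B (v (projIcc 0 S hS s))
  have hg : ∀ v, Continuous (g v) := fun v => hB.comp (v.continuous.comp continuous_projIcc)
  let F : C(Icc 0 S, H) → C(Icc 0 S, H) := fun v =>
    ⟨fun t => unitaryGroup A (∫ r in (0 : ℝ)..t, a r) u₀
      - Complex.I • ∫ s in (0 : ℝ)..t, b s • unitaryGroup A (∫ r in s..t, a r) (g v s),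
    (((hUiso.continuous_orbit u₀).comp ha.continuous_primitive).sub
      ((continuous_duhamel A ha hb (hg v)).const_smul Complex.I)).comp continuous_subtype_val⟩
  let c : C(Icc 0 S, H) := ContinuousMap.const _ u₀
  have hball : ∀ v ∈ Metric.closedBall c ρ, ∀ t, ‖v t - u₀‖ ≤ ρ := fun v hv t => by
    rw [← dist_eq_norm]
    exact (ContinuousMap.dist_apply_le_dist (f := v) (g := c) t).trans (Metric.mem_closedBall.1 hv)
  have hmaps : MapsTo F (Metric.closedBall c ρ) (Metric.closedBall c ρ) := fun v hv => by
    rw [Metric.mem_closedBall, ContinuousMap.dist_le hρ.le]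
    intro t
    rw [dist_eq_norm]
    exact (norm_duhamel_sub_lt ha hb hρ hUS hMS t.2 fun s _ => hM _ (hball v hv _)).le
  have hcontr : ContractingWith (1 / 2 : ℝ≥0)
      (hmaps.restrict F (Metric.closedBall c ρ) (Metric.closedBall c ρ)) := by
    refine ⟨by rw [← NNReal.coe_lt_coe]; norm_num, LipschitzWith.of_dist_le_mul ?_⟩
    rintro ⟨v, hv⟩ ⟨w, hw⟩
    change dist (F v) (F w) ≤ _ * dist v w
    rw [ContinuousMap.dist_le (by positivity)]
    intro t
    have hint := fun v : C(Icc 0 S, H) => intervalIntegrable_duhamel A ha hb (g := g v) (t := t)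
      (hg v).continuousOn
    have hFF : F v t - F w t = -(Complex.I • ∫ s in (0 : ℝ)..t,
        b s • unitaryGroup A (∫ r in s..(t : ℝ), a r) (g v s - g w s)) := by
      simp only [map_sub, smul_sub]
      rw [intervalIntegral.integral_sub (hint v) (hint w), smul_sub]
      exact sub_sub_sub_cancel_left _ _ _ |>.trans (neg_sub _ _).symm
    have hbd := hb.norm_integral_smul_le (M := L * dist v w) t.2.1
      (g := fun s => unitaryGroup A (∫ r in s..(t : ℝ), a r) (g v s - g w s)) (fun s _ => by
        rw [hUiso.norm_apply, ← dist_eq_norm]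
        refine (hL.dist_le_mul _ ?_ _ ?_).trans
          (mul_le_mul_of_nonneg_left (ContinuousMap.dist_apply_le_dist _) L.2)
        · rw [mem_closedBall_iff_norm]; exact hball v hv _
        · rw [mem_closedBall_iff_norm]; exact hball w hw _)
    rw [dist_eq_norm, hFF, norm_neg, norm_smul, Complex.norm_I, one_mul]
    refine hbd.trans ?_
    have hKL : 0 ≤ K * L := mul_nonneg hb.nonneg L.2
    have h1 : K * L * t ≤ 1 / 2 := (mul_le_mul_of_nonneg_left t.2.2 hKL).trans hLS
    calc K * (L * dist v w) * t = (K * L * t) * dist v w := by ring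
      _ ≤ 1 / 2 * dist v w := mul_le_mul_of_nonneg_right h1 dist_nonneg
      _ = _ := by norm_num
  obtain ⟨v, -, hv, -⟩ := hcontr.exists_fixedPoint' Metric.isClosed_closedBall.isComplete hmaps
    (Metric.mem_closedBall_self hρ.le) (edist_ne_top _ _)
  refine ⟨fun t => v (projIcc 0 S hS t), (v.continuous.comp continuous_projIcc).continuousOn,
    fun t ht => ?_⟩
  simp only [projIcc_of_mem hS ht]
  exact (DFunLike.congr_fun hv ⟨t, ht⟩).symm

/-- Uniqueness is not needed: the estimates below hold for every mild solution, hence for the chosen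
one. -/
theorem isMildSolution_of_flowDefined {t : ℝ} (h : FlowDefined A B a b t u₀) :
    ∃ u, IsMildSolution A B a b u₀ t u ∧ flow A B a b t u₀ = u t :=
  ⟨h.choose, h.choose_spec, by rw [flow, dif_pos h]⟩

end Solutions

/-! ### Second-order consistency -/

section LocalError

variable {H₁ H₀ : Type*}
  [NormedAddCommGroup H₁] [InnerProductSpace ℂ H₁] [CompleteSpace H₁]
  [NormedAddCommGroup H₀] [InnerProductSpace ℂ H₀]
  {ι : H₁ →L[ℂ] H₀} {A : H₁ →ₗ.[ℂ] H₁} {B : H₁ → H₁} {a b : ℝ → ℝ} {u₀ : H₁} {K S N M D : ℝ}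

/-- In the norm of the larger space, solutions are Lipschitz continuous at time `0`. -/
theorem IsMildSolution.norm_embedding_sub_le (ha : IsBoundedCoefficient K a)
    (hb : IsBoundedCoefficient K b) (hN : 0 ≤ N)
    (hUN : ∀ t x, ‖ι (unitaryGroup A t x) - ι x‖ ≤ N * |t| * ‖x‖) {u : ℝ → H₁}
    (hu : IsMildSolution A B a b u₀ S u) (hM : ∀ s ∈ Icc 0 S, ‖B (u s)‖ ≤ M) {t : ℝ}
    (ht : t ∈ Icc 0 S) : ‖ι (u t) - ι u₀‖ ≤ K * (N * ‖u₀‖ + ‖ι‖ * M) * t := by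
  have h1 : ‖ι (unitaryGroup A (∫ r in (0 : ℝ)..t, a r) u₀) - ι u₀‖ ≤ N * (K * t) * ‖u₀‖ := by
    refine (hUN _ _).trans ?_
    have := ha.abs_integral_le 0 t
    rw [sub_zero, abs_of_nonneg ht.1] at this
    gcongr
  have h2 := hb.norm_integral_smul_le (M := M) ht.1
    (g := fun s => unitaryGroup A (∫ r in s..t, a r) (B (u s))) (fun s hs => by
      rw [(isIsometryGroup_unitaryGroup A).norm_apply]
      exact hM s ⟨hs.1.le, hs.2.le.trans ht.2⟩)
  rw [hu.duhamel t ht, map_sub, sub_right_comm]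
  refine (norm_sub_le _ _).trans ?_
  rw [map_smul, norm_smul, Complex.norm_I, one_mul]
  have h3 := (ι.le_opNorm _).trans (mul_le_mul_of_nonneg_left h2 (norm_nonneg ι))
  linarith

/-- Consistency of one step with `Φ^A(h) u₀ - i h B(u₀)`. -/
theorem IsMildSolution.norm_embedding_sub_euler_le [CompleteSpace H₀]
    (ha : IsBoundedCoefficient K a)
    (hb : IsBoundedCoefficient K b) (hB : Continuous B) (hN : 0 ≤ N) (hD : 0 ≤ D)
    (hUN : ∀ t x, ‖ι (unitaryGroup A t x) - ι x‖ ≤ N * |t| * ‖x‖) (hS : 0 ≤ S) {u : ℝ → H₁}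
    (hu : IsMildSolution A B a b u₀ S u) (hM : ∀ s ∈ Icc 0 S, ‖B (u s)‖ ≤ M)
    (huD : ∀ s ∈ Icc 0 S, ‖ι (B (u s)) - ι (B u₀)‖ ≤ D * ‖ι (u s) - ι u₀‖)
    (haS : ∫ t in (0 : ℝ)..S, a t = S) (hbS : ∫ t in (0 : ℝ)..S, b t = S) :
    ‖ι (u S) - ι (unitaryGroup A S u₀ - Complex.I • S • B u₀)‖ ≤
      K * (N * K * M + D * (K * (N * ‖u₀‖ + ‖ι‖ * M))) * S ^ 2 := by
  have hSS : S ∈ Icc 0 S := ⟨hS, le_rfl⟩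
  have hM0 : 0 ≤ M := (norm_nonneg _).trans (hM S hSS)
  have hK := ha.nonneg
  have hint := intervalIntegrable_duhamel A ha hb (g := fun s => B (u s)) (t := S)
    (by rw [uIcc_of_le hS]; exact hB.comp_continuousOn hu.continuousOn)
  have hint' : IntervalIntegrable (fun s => b s • B u₀) volume 0 S :=
    hb.intervalIntegrable_smul continuousOn_const
  have heq : ι (u S) - ι (unitaryGroup A S u₀ - Complex.I • S • B u₀) =
      -(Complex.I • ∫ s in (0 : ℝ)..S,
        b s • (ι (unitaryGroup A (∫ r in s..S, a r) (B (u s))) - ι (B u₀))) := by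
    have h1 : S • B u₀ = ∫ s in (0 : ℝ)..S, b s • B u₀ := by
      rw [intervalIntegral.integral_smul_const, hbS]
    have h2 : ∀ s, b s • (ι (unitaryGroup A (∫ r in s..S, a r) (B (u s))) - ι (B u₀)) =
        ι (b s • unitaryGroup A (∫ r in s..S, a r) (B (u s)) - b s • B u₀) := fun s => by
      rw [map_sub, ContinuousLinearMap.map_smul_of_tower, ContinuousLinearMap.map_smul_of_tower,
        smul_sub]
    simp_rw [h2]
    rw [ContinuousLinearMap.intervalIntegral_comp_comm _ (hint.sub hint'),
      intervalIntegral.integral_sub hint hint', ← h1, hu.duhamel S hSS, haS, ← map_sub,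
      ← map_smul, ← map_neg, smul_sub]
    congr 1
    abel
  rw [heq, norm_neg, norm_smul, Complex.norm_I, one_mul]
  have hbd := hb.norm_integral_smul_le (M := N * (K * S) * M
      + D * (K * (N * ‖u₀‖ + ‖ι‖ * M) * S)) hS
    (g := fun s => ι (unitaryGroup A (∫ r in s..S, a r) (B (u s))) - ι (B u₀)) (fun s hs => by
      have hs' : s ∈ Icc 0 S := ⟨hs.1.le, hs.2.le⟩
      -- The group moves `B (u s)` by `O(S)` in `H₀`, and `B (u s)` differs from `B u₀` by `O(s)`.
      rw [← sub_add_sub_cancel _ (ι (B (u s)))]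
      refine (norm_add_le _ _).trans (add_le_add ((hUN _ _).trans ?_) ((huD s hs').trans ?_))
      · have h1 := ha.abs_integral_le s S
        have h2 : |S - s| ≤ S := by rw [abs_of_nonneg (by linarith [hs.2])]; linarith [hs.1]
        have h3 := h1.trans (mul_le_mul_of_nonneg_left h2 hK)
        have h4 := hM s hs'
        gcongr
      · refine mul_le_mul_of_nonneg_left
          ((hu.norm_embedding_sub_le ha hb hN hUN hM hs').trans ?_) hD
        have := hs'.2
        gcongr)
  refine hbd.trans_eq ?_
  ring

/-- For all coefficients with essential bound `K` and mean value `1` over a sufficiently short time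
interval, the flow is defined and agrees to second order with `Φ^A(h) u₀ - i h B(u₀)`. -/
theorem exists_norm_flow_sub_euler_le [CompleteSpace H₀] (ι : H₁ →L[ℂ] H₀) (hB : LocallyLipschitz B) {N : ℝ}
    (hN : 0 ≤ N) (hUN : ∀ t x, ‖ι (unitaryGroup A t x) - ι x‖ ≤ N * |t| * ‖x‖)
    {B' : H₁ → H₀ →L[ℝ] H₀} (hB' : LinearizationEstimates ι B B') (u₀ : H₁) {K : ℝ} (hK : 0 < K) :
    ∃ C S : ℝ, 0 < S ∧ ∀ h ∈ Icc 0 S, ∀ a b : ℝ → ℝ,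
      IsBoundedCoefficient K a → IsBoundedCoefficient K b →
      ∫ t in (0 : ℝ)..h, a t = h → ∫ t in (0 : ℝ)..h, b t = h →
      FlowDefined A B a b h u₀ ∧
      ‖ι (flow A B a b h u₀) - ι (unitaryGroup A h u₀ - Complex.I • h • B u₀)‖ ≤ C * h ^ 2 := by
  -- Only linearization at `u₀` with `ε = 1` is used; it yields the `H₀` Lipschitz constant `D + 1`.
  -- The `+ 1` in the radius makes it positive.
  obtain ⟨D, δ, hδ, hDδ⟩ := hB' (‖u₀‖ + 1) (by positivity) 1 one_pos
  obtain ⟨L, V, hV, hLV⟩ := hB u₀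
  obtain ⟨r, hr, hrV⟩ := Metric.mem_nhds_iff.1 hV
  obtain ⟨ρ, hρ, hρr, hρδ⟩ : ∃ ρ > 0, ρ < r ∧ ρ < δ :=
    ⟨min r δ / 2, by positivity, by linarith [min_le_left r δ, lt_min hr hδ],
      by linarith [min_le_right r δ, lt_min hr hδ]⟩
  have hL : LipschitzOnWith L B (Metric.closedBall u₀ ρ) :=
    hLV.mono ((Metric.closedBall_subset_ball hρr).trans hrV)
  have hM : ∀ x, ‖x - u₀‖ ≤ ρ → ‖B x‖ ≤ ‖B u₀‖ + L * ρ := fun x hx => by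
    have h1 := hL.dist_le_mul x (mem_closedBall_iff_norm.2 hx) u₀
      (Metric.mem_closedBall_self hρ.le)
    rw [dist_eq_norm, dist_eq_norm] at h1
    have h2 := mul_le_mul_of_nonneg_left hx L.coe_nonneg
    have h3 := norm_le_norm_add_norm_sub' (B x) (B u₀)
    linarith
  have hD0 : 0 ≤ D := (norm_nonneg _).trans
    (hDδ u₀ 0 (by linarith) (by rwa [norm_zero])).1
  have hD : ∀ x, ‖x - u₀‖ ≤ ρ → ‖ι (B x) - ι (B u₀)‖ ≤ (D + 1) * ‖ι x - ι u₀‖ := fun x hx => by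
    obtain ⟨h1, h2⟩ := hDδ u₀ (x - u₀) (by linarith) (hx.trans_lt hρδ)
    rw [add_sub_cancel, map_sub] at h2
    have h3 := (B' u₀).le_of_opNorm_le h1 (ι x - ι u₀)
    have h4 := norm_le_norm_add_norm_sub' (ι (B x) - ι (B u₀)) (B' u₀ (ι x - ι u₀))
    linarith
  obtain ⟨η, hη, hUη⟩ := (isIsometryGroup_unitaryGroup A).exists_norm_sub_le u₀
    (ε := ρ / 3) (by positivity)
  set M : ℝ := ‖B u₀‖ + L * ρ with hMdef
  have hM0 : 0 ≤ M := by positivity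
  obtain ⟨S, hS, hS1, hS2, hS3⟩ : ∃ S > 0, K * S ≤ η ∧ K * M * S ≤ ρ / 3 ∧ K * L * S ≤ 1 / 2 := by
    have hsmall : ∀ c : ℝ, ∀ ε > 0, ∀ᶠ S in nhdsWithin (0 : ℝ) (Ioi 0), c * S ≤ ε := by
      intro c ε hε
      have : Filter.Tendsto (fun S : ℝ => c * S) (nhdsWithin 0 (Ioi 0)) (nhds (c * 0)) :=
        ((continuous_const_mul c).tendsto 0).mono_left nhdsWithin_le_nhds
      rw [mul_zero] at this
      exact (this.eventually_lt_const hε).mono fun _ h => h.le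
    obtain ⟨S, h1, h2, h3, h4⟩ := ((eventually_mem_nhdsWithin (a := (0 : ℝ)) (s := Ioi 0)).and ((hsmall K η hη).and
      ((hsmall (K * M) (ρ / 3) (by positivity)).and (hsmall (K * L) (1 / 2) (by norm_num))))).exists
    exact ⟨S, h1, h2, h3, h4⟩
  refine ⟨K * (N * K * M + (D + 1) * (K * (N * ‖u₀‖ + ‖ι‖ * M))), S, hS,
    fun h hh a b ha hb hah hbh => ?_⟩
  have hUS : ∀ t, |t| ≤ K * h → ‖unitaryGroup A t u₀ - u₀‖ ≤ ρ / 3 := fun t ht =>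
    hUη t (ht.trans ((mul_le_mul_of_nonneg_left hh.2 hK.le).trans hS1))
  have hMh : K * M * h ≤ ρ / 3 := (mul_le_mul_of_nonneg_left hh.2 (by positivity)).trans hS2
  have hLh : K * L * h ≤ 1 / 2 := (mul_le_mul_of_nonneg_left hh.2 (by positivity)).trans hS3
  have hdef : FlowDefined A B a b h u₀ :=
    flowDefined_of_lipschitzOnWith hB.continuous hL ha hb hh.1 hρ hUS hMh hM hLh
  obtain ⟨u, hu, hflow⟩ := isMildSolution_of_flowDefined hdef
  have huρ : ∀ s ∈ Icc 0 h, ‖u s - u₀‖ ≤ ρ := fun s hs =>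
    (hu.norm_sub_lt ha hb hρ hUS hMh hM hs).le
  refine ⟨hdef, ?_⟩
  rw [hflow]
  exact hu.norm_embedding_sub_euler_le ha hb hB.continuous hN (by positivity) hUN hh.1
    (fun s hs => hM _ (huρ s hs)) (fun s hs => hD _ (huρ s hs)) hah hbh

end LocalError

end Splitting

/-! ### Comparison of the two flows -/

theorem theorem3p9
    {H₁ H₀ : Type*}
    [NormedAddCommGroup H₁] [InnerProductSpace ℂ H₁] [CompleteSpace H₁]
    [NormedAddCommGroup H₀] [InnerProductSpace ℂ H₀] [CompleteSpace H₀]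
    (ι : H₁ →L[ℂ] H₀) (hι : Function.Injective ι)
    (A : H₁ →ₗ.[ℂ] H₁) (hA : IsSelfAdjoint A)
    (A₀ : H₀ →ₗ.[ℂ] H₀) (hA₀ : IsSelfAdjoint A₀)
    (hext : Splitting.Extends ι A A₀) (hdom : ∀ x : H₁, ι x ∈ A₀.domain)
    (B : H₁ → H₁) (hB : LocallyLipschitz B)
    (B' : H₁ → H₀ →L[ℝ] H₀) (hB' : Splitting.LinearizationEstimates ι B B')
    (u₀ : H₁) (T : ℝ) (hT : 0 < T) (hTmax : ENNReal.ofReal T < Splitting.maximalTime A B u₀)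
    (α β : ℝ → ℝ) (hα : Splitting.IsSplittingCoefficient T α)
    (hβ : Splitting.IsSplittingCoefficient T β) :
    ∃ C : ℝ, 0 < C ∧ ∃ n₀ : ℕ, ∀ n : ℕ, n₀ ≤ n →
      Splitting.SplittingFlowDefined A B α β n (T / n) u₀ ∧
      ‖ι (Splitting.exactFlow A B (T / n) u₀)
          - ι (Splitting.splittingFlow A B α β n (T / n) u₀)‖ ≤ C * (T / n) ^ 2 := by
  obtain ⟨N, hN, hUN⟩ := Splitting.exists_norm_unitaryGroup_sub_le ι hA hA₀ hext hdom
  obtain ⟨Kα, hKα⟩ := Splitting.exists_isBoundedCoefficient hα.bounded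
  obtain ⟨Kβ, hKβ⟩ := Splitting.exists_isBoundedCoefficient hβ.bounded
  -- `1 ≤ K` lets the same bound cover the constant coefficients of the exact flow.
  obtain ⟨K, hK, hαK, hβK⟩ : ∃ K, 1 ≤ K ∧ Kα ≤ K ∧ Kβ ≤ K :=
    ⟨max 1 (max Kα Kβ), by simp, by simp, by simp⟩
  obtain ⟨C, S, hS, hflow⟩ := Splitting.exists_norm_flow_sub_euler_le ι hB hN hUN hB' u₀
    (zero_lt_one.trans_le hK)
  obtain ⟨m, hm⟩ := exists_nat_ge (T / S)
  -- `C` comes without a sign, hence `|C|`, once for each flow; `+ 1` gives positivity. Starting at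
  -- `m + 1` ensures `n ≠ 0`.
  refine ⟨2 * |C| + 1, by positivity, m + 1, fun n hn => ?_⟩
  have hn0 : n ≠ 0 := by omega
  have hn0' : (0 : ℝ) < n := Nat.cast_pos.2 (Nat.pos_of_ne_zero hn0)
  have hmn : (m : ℝ) ≤ n := Nat.cast_le.2 (by omega)
  have hh : T / n ∈ Icc 0 S :=
    ⟨by positivity, (div_le_comm₀ hS hn0').1 (hm.trans hmn)⟩
  have h1 : Splitting.IsBoundedCoefficient K fun _ => 1 := Splitting.isBoundedCoefficient_one.mono hK
  have hone : ∫ _ in (0 : ℝ)..T / n, (1 : ℝ) = T / n := by simp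
  obtain ⟨-, hexact⟩ := hflow _ hh _ _ h1 h1 hone hone
  obtain ⟨hdef, hsplit⟩ := hflow _ hh _ _ ((hKα.mono hαK).comp_mul_left hn0'.ne')
    ((hKβ.mono hβK).comp_mul_left hn0'.ne') (hα.integral_comp_mul_left hT hn0)
    (hβ.integral_comp_mul_left hT hn0)
  refine ⟨hdef, ?_⟩
  rw [Splitting.exactFlow, Splitting.splittingFlow]
  refine (norm_sub_le_norm_sub_add_norm_sub _
    (ι (Splitting.unitaryGroup A (T / n) u₀ - Complex.I • (T / n : ℝ) • B u₀)) _).trans ?_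
  rw [norm_sub_rev _ (ι (Splitting.flow A B (fun s => α (n * s)) _ _ _))]
  have h2 := mul_le_mul_of_nonneg_right (le_abs_self C) (sq_nonneg (T / (n : ℝ)))
  have h3 := sq_nonneg (T / (n : ℝ))
  linarith
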